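/- **Theorem (Eilenberg–Mac Lane).** Let $G, M$ be abelian groups, written additively. An *abelian 3-cocycle* is a pair $(h,c)$ of maps of sets $h\colon G^3\to M$ and $c\colon G^2\to M$ such that, for all $u,x,y,z\in G$, $$h(x,y,z)+h(u,x+y,z)+h(u,x,y)=h(u,x,y+z)+h(u+x,y,z),\qquad h(x,0,z)=0,$$ $$h(y,z,x)+c(x,y+z)+h(x,y,z)=c(x,z)+h(y,x,z)+c(x,y),$$ $$-h(z,x,y)+c(x+y,z)-h(x,y,z)=c(x,z)-h(x,z,y)+c(y,z).$$ An *abelian 3-coboundary* is a pair $(h,c)$ of the form $$h(x,y,z)=k(y,z)-k(x+y,z)+k(x,y+z)-k(x,y),\qquad c(x,y)=k(y,x)-k(x,y)$$ for some map $k\colon G^2\to M$ with $k(x,0)=k(0,x)=0$ for all $x\in G$. Under pointwise addition the abelian 3-cocycles form a group $Z^3_{ab}(G,M)$ which contains the abelian 3-coboundaries as a subgroup $B^3_{ab}(G,M)$; put $H^3_{ab}(G,M)=Z^3_{ab}(G,M)/B^3_{ab}(G,M)$. A *quadratic form* is a map of sets $q\colon G\to M$ such that $q(-x)=q(x)$ for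 all $x\in G$ and $(x,y)\mapsto q(x+y)-q(x)-q(y)$ is $\mathbb{Z}$-bilinear; let $\operatorname{Quad}(G,M)$ be the group of quadratic forms under pointwise addition. Then the trace $$\operatorname{tr}\colon H^3_{ab}(G,M)\longrightarrow \operatorname{Quad}(G,M),\qquad [(h,c)]\longmapsto \bigl(x\mapsto c(x,x)\bigr)$$ is well defined (for every abelian 3-cocycle $(h,c)$ the map $x\mapsto c(x,x)$ is a quadratic form, and it depends only on the class of $(h,c)$) and is an isomorphism of abelian groups. -/

import Mathlib

namespace AbelianCohomology

variable (G M : Type*) [AddCommGroup G] [AddCommGroup M]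

/-- The group of abelian 3-cocycles on `G` with values in `M` (under pointwise addition):
pairs `(h, c)` of functions `h : G³ → M` and `c : G² → M` such that `h` is a group 3-cocycle
with `h (x, 0, z) = 0` and the two hexagon identities hold. -/
def cocycles : AddSubgroup ((G → G → G → M) × (G → G → M)) where
  carrier := {p |
    (∀ u x y z, p.1 x y z + p.1 u (x + y) z + p.1 u x y
        = p.1 u x (y + z) + p.1 (u + x) y z) ∧
    (∀ x z, p.1 x 0 z = 0) ∧
    (∀ x y z, p.1 y z x + p.2 x (y + z) + p.1 x y z
        = p.2 x z + p.1 y x z + p.2 x y) ∧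
    (∀ x y z, -p.1 z x y + p.2 (x + y) z - p.1 x y z
        = p.2 x z - p.1 x z y + p.2 y z)}
  zero_mem' := by simp
  add_mem' := by
    rintro ⟨h, c⟩ ⟨h', c'⟩ ⟨h1, h2, h3, h4⟩ ⟨h1', h2', h3', h4'⟩
    simp only at h1 h2 h3 h4 h1' h2' h3' h4'
    refine ⟨fun u x y z => ?_, fun x z => ?_, fun x y z => ?_, fun x y z => ?_⟩ <;>
      simp only [Prod.mk_add_mk, Pi.add_apply]
    · linear_combination (norm := abel) h1 u x y z + h1' u x y z
    · rw [h2, h2', add_zero]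
    · linear_combination (norm := abel) h3 x y z + h3' x y z
    · linear_combination (norm := abel) h4 x y z + h4' x y z
  neg_mem' := by
    rintro ⟨h, c⟩ ⟨h1, h2, h3, h4⟩
    simp only at h1 h2 h3 h4
    refine ⟨fun u x y z => ?_, fun x z => ?_, fun x y z => ?_, fun x y z => ?_⟩ <;>
      simp only [Prod.neg_mk, Pi.neg_apply]
    · linear_combination (norm := abel) -h1 u x y z
    · rw [h2, neg_zero]
    · linear_combination (norm := abel) -h3 x y z
    · linear_combination (norm := abel) -h4 x y z

/-- The group of abelian 3-coboundaries on `G` with values in `M`: the pairs `(h, c)` with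
`h (x, y, z) = k (y, z) - k (x + y, z) + k (x, y + z) - k (x, y)` and
`c (x, y) = k (y, x) - k (x, y)` for one function `k : G² → M` such that
`k (x, 0) = k (0, x) = 0`. -/
def coboundaries : AddSubgroup ((G → G → G → M) × (G → G → M)) where
  carrier := {p | ∃ k : G → G → M, (∀ x, k x 0 = 0) ∧ (∀ y, k 0 y = 0) ∧
    (∀ x y z, p.1 x y z = k y z - k (x + y) z + k x (y + z) - k x y) ∧
    (∀ x y, p.2 x y = k y x - k x y)}
  zero_mem' := ⟨0, by simp⟩
  add_mem' := by
    rintro ⟨h, c⟩ ⟨h', c'⟩ ⟨k, k1, k2, hh, hc⟩ ⟨k', k1', k2', hh', hc'⟩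
    simp only at hh hc hh' hc'
    refine ⟨k + k', fun x => ?_, fun y => ?_, fun x y z => ?_, fun x y => ?_⟩ <;>
      simp only [Prod.mk_add_mk, Pi.add_apply]
    · rw [k1, k1', add_zero]
    · rw [k2, k2', add_zero]
    · rw [hh, hh']; abel
    · rw [hc, hc']; abel
  neg_mem' := by
    rintro ⟨h, c⟩ ⟨k, k1, k2, hh, hc⟩
    simp only at hh hc
    refine ⟨-k, fun x => ?_, fun y => ?_, fun x y z => ?_, fun x y => ?_⟩ <;>
      simp only [Prod.neg_mk, Pi.neg_apply]
    · rw [k1, neg_zero]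
    · rw [k2, neg_zero]
    · rw [hh]; abel
    · rw [hc]; abel

/-- Every abelian 3-coboundary is an abelian 3-cocycle. -/
theorem coboundaries_le_cocycles : coboundaries G M ≤ cocycles G M := by
  rintro ⟨h, c⟩ ⟨k, k1, k2, hh, hc⟩
  simp only at hh hc
  refine ⟨fun u x y z => ?_, fun x z => ?_, fun x y z => ?_, fun x y z => ?_⟩ <;>
    simp only [hh, hc]
  · simp only [add_assoc]; abel
  · simp only [k1, k2, add_zero, zero_add]; abel
  · rw [add_comm z x, add_comm y x]; abel
  · rw [add_comm z x, add_comm z y]; abel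

/-- Third abelian cohomology: abelian 3-cocycles modulo abelian 3-coboundaries. -/
abbrev H3ab : Type _ := cocycles G M ⧸ (coboundaries G M).addSubgroupOf (cocycles G M)

/-- The polarization `b (x, y) = q (x + y) - q x - q y` of a function `q : G → M`. -/
def polarization {G M : Type*} [AddCommGroup G] [AddCommGroup M] (q : G → M) (x y : G) : M :=
  q (x + y) - q x - q y

/-- The group of quadratic forms on `G` with values in `M` (under pointwise addition): the
functions `q : G → M` with `q (-x) = q x` whose polarization is `ℤ`-bilinear, that is,
additive in each of the two variables. -/
def Quad : AddSubgroup (G → M) where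
  carrier := {q | (∀ x, q (-x) = q x) ∧
    (∀ x x' y, polarization q (x + x') y = polarization q x y + polarization q x' y) ∧
    (∀ x y y', polarization q x (y + y') = polarization q x y + polarization q x y')}
  zero_mem' := by simp [polarization]
  add_mem' := by
    rintro q q' ⟨h1, h2, h3⟩ ⟨h1', h2', h3'⟩
    have key : ∀ x y, polarization (q + q') x y = polarization q x y + polarization q' x y := by
      intro x y; simp only [polarization, Pi.add_apply]; abel
    refine ⟨fun x => ?_, fun x x' y => ?_, fun x y y' => ?_⟩
    · simp only [Pi.add_apply, h1, h1']
    · simp only [key, h2, h2']; abel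
    · simp only [key, h3, h3']; abel
  neg_mem' := by
    rintro q ⟨h1, h2, h3⟩
    have key : ∀ x y, polarization (-q) x y = -polarization q x y := by
      intro x y; simp only [polarization, Pi.neg_apply]; abel
    refine ⟨fun x => ?_, fun x x' y => ?_, fun x y y' => ?_⟩
    · simp only [Pi.neg_apply, h1]
    · simp only [key, h2]; abel
    · simp only [key, h3]; abel

end AbelianCohomology

/-! The hexagons and the pentagon give `c x y + c y x` as the polarization of the trace, which is
therefore quadratic; on coboundaries it vanishes.

Injectivity: if `c x x = 0`, then `c` is antisymmetric, and a total order on `G` writes it as an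
antisymmetrization. Subtracting a coboundary leaves `(h, 0)`, with `h` an `IsSymmCocycle`. On a free
group such an `h` is `delta k`, by recursion on `ℤ` and `IsSymmCocycle.rect_identity` for direct
sums, and `k` can be made symmetric. For general `G`, pull back along a free presentation with
kernel `R`. As `R` is free, symmetric 2-cocycles on it split, and the primitive can be corrected
until it is `R`-invariant (`exists_descent`).

Surjectivity: on the free group the pulled back form is `B x x` with `B` bilinear. On `R`, `B` is
alternating, hence the antisymmetrization of a bilinear `k`; with a section of the presentation, `B`
and `k` give an explicit cocycle on `G`. -/

namespace AbelianCohomology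

/-! ### Submodules of free modules over a principal ideal domain -/

/-- A submodule of a free module over a principal ideal domain is free, in arbitrary rank. -/
theorem free_submodule_finsupp {R ι : Type*} [CommRing R] [IsDomain R] [IsPrincipalIdealRing R]
    (N : Submodule R (ι →₀ R)) : Module.Free R N := by
  classical
  obtain ⟨_, _⟩ := exists_wellFoundedLT ι
  let low (i : ι) : Submodule R (ι →₀ R) :=
    { carrier := {x | ∀ j, i < j → x j = 0}
      zero_mem' := fun _ _ => rfl
      add_mem' := fun {x y} hx hy j hj => by simp [hx j hj, hy j hj]
      smul_mem' := fun a x hx j hj => by simp [hx j hj] }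
  -- The ideal of leading coefficients at `i`; the lifts of its nonzero generators form an echelon
  -- basis of `N`.
  let I (i : ι) : Ideal R := (N ⊓ low i).map (Finsupp.lapply i)
  have hgen (i : ι) : ∃ x ∈ N ⊓ low i, x i = Submodule.IsPrincipal.generator (I i) :=
    Submodule.IsPrincipal.generator_mem (I i)
  choose v hv hvi using hgen
  let J := {i : ι // Submodule.IsPrincipal.generator (I i) ≠ 0}
  let w : J → N := fun i => ⟨v i, (hv i).1⟩
  have hli : LinearIndependent R w := by
    refine LinearIndependent.of_comp N.subtype ?_
    rw [linearIndependent_iff]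
    intro l hl
    by_contra hne
    have hs : l.support.Nonempty := Finsupp.support_nonempty_iff.2 hne
    set m := l.support.max' hs
    have hmem : m ∈ l.support := Finset.max'_mem _ _
    have h0 := DFunLike.congr_fun hl m.1
    rw [Finsupp.linearCombination_apply, Finsupp.sum, Finsupp.finsetSum_apply,
      Finset.sum_eq_single_of_mem m hmem] at h0
    · have : l m * v m m = 0 := h0
      rw [hvi] at this
      exact (mul_ne_zero (Finsupp.mem_support_iff.1 hmem) m.2) this
    · intro j hj hjm
      have : j < m := lt_of_le_of_ne (Finset.le_max' _ _ hj) hjm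
      have h1 : v j m = 0 := (hv j).2 m this
      change l j * v j m = 0
      rw [h1, mul_zero]
  have hspan : ∀ i, ∀ n : N, (n : ι →₀ R) ∈ low i → n ∈ Submodule.span R (Set.range w) := by
    intro i
    induction i using WellFoundedLT.induction with
    | ind i ih =>
      have key : ∀ n : N, (n : ι →₀ R) ∈ low i → (n : ι →₀ R) i = 0 →
          n ∈ Submodule.span R (Set.range w) := by
        intro n hn hni
        by_cases h0 : (n : ι →₀ R) = 0
        · rw [show n = 0 from Subtype.ext h0]
          exact Submodule.zero_mem _
        · have hs := Finsupp.support_nonempty_iff.2 h0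
          refine ih ((n : ι →₀ R).support.max' hs) ?_ n ?_
          · have hmem := Finsupp.mem_support_iff.1 (Finset.max'_mem _ hs)
            by_contra hlt
            rcases (not_lt.1 hlt).eq_or_lt with h | h
            · exact hmem (h ▸ hni)
            · exact hmem (hn _ h)
          · intro j hj
            by_contra hne
            exact absurd (Finset.le_max' _ _ (Finsupp.mem_support_iff.2 hne)) (not_le.2 hj)
      intro n hn
      have hmem : (n : ι →₀ R) i ∈ I i := ⟨n, ⟨n.2, hn⟩, rfl⟩
      obtain ⟨a, ha⟩ := (Submodule.IsPrincipal.mem_iff_eq_smul_generator (I i)).1 hmem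
      by_cases hg : Submodule.IsPrincipal.generator (I i) = 0
      · exact key n hn (by rw [ha, hg, smul_zero])
      · have hw : w ⟨i, hg⟩ ∈ Submodule.span R (Set.range w) := Submodule.subset_span ⟨_, rfl⟩
        have h1 := key (n - a • w ⟨i, hg⟩) ((low i).sub_mem hn ((low i).smul_mem a (hv i).2)) (by
          change (n : ι →₀ R) i - a * v i i = 0
          rw [hvi, ha, smul_eq_mul, sub_self])
        have h2 := Submodule.add_mem _ h1 (Submodule.smul_mem _ a hw)
        exact (Subtype.ext (sub_add_cancel (n : ι →₀ R) _) :
          n - a • w ⟨i, hg⟩ + a • w ⟨i, hg⟩ = n) ▸ h2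
  refine Module.Free.of_basis (Module.Basis.mk hli ?_)
  intro n _
  by_cases h0 : (n : ι →₀ R) = 0
  · rw [show n = 0 from Subtype.ext h0]
    exact Submodule.zero_mem _
  · refine hspan ((n : ι →₀ R).support.max' (Finsupp.support_nonempty_iff.2 h0)) n ?_
    intro j hj
    by_contra hne
    exact absurd (Finset.le_max' _ _ (Finsupp.mem_support_iff.2 hne)) (not_le.2 hj)

theorem free_submodule {R V : Type*} [CommRing R] [IsDomain R] [IsPrincipalIdealRing R]
    [AddCommGroup V] [Module R V] [Module.Free R V] (N : Submodule R V) : Module.Free R N :=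
  let e := (Module.Free.chooseBasis R V).repr
  have := free_submodule_finsupp (N.map e.toLinearMap)
  Module.Free.of_equiv (e.submoduleMap N).symm

end AbelianCohomology
-- Consequences of the cocycle identities
namespace AbelianCohomology

variable {G M : Type*} [AddCommGroup G] [AddCommGroup M]

/-- The group coboundary of a 2-cochain. -/
def delta (k : G → G → M) (x y z : G) : M := k y z - k (x + y) z + k x (y + z) - k x y

/-- The condition on `h` for `(h, 0)` to be an abelian 3-cocycle. -/
structure IsSymmCocycle (h : G → G → G → M) : Prop where
  pentagon : ∀ u x y z, h x y z + h u (x + y) z + h u x y = h u x (y + z) + h (u + x) y z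
  mid_zero : ∀ x z, h x 0 z = 0
  hexagon : ∀ x y z, h y z x + h x y z = h y x z
  hexagon' : ∀ x y z, h z x y + h x y z = h x z y

section Cocycle

variable {h : G → G → G → M} {c : G → G → M} (hc : (h, c) ∈ cocycles G M)
include hc

theorem cocycle_zero_right (x : G) : c x 0 = 0 := by
  obtain ⟨h1, h2, h3, h4⟩ := hc
  have e := h3 x 0 0
  have e1 := h1 0 0 x 0
  simp only [add_zero, zero_add] at h1 h2 e e1
  linear_combination (norm := abel) -e + h2 0 x + h2 x 0 - e1

/-- Hexagons expand `c (x + y) (x + y)` in both variables; the remaining `h`-terms cancel by the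
pentagon at `(x, y, x, y)`. -/
theorem polarization_trace (x y : G) :
    polarization (fun x => c x x) x y = c x y + c y x := by
  obtain ⟨h1, h2, h3, h4⟩ := hc
  have e1 := h4 x y (x + y)
  have e2 := h3 x x y
  have e3 := h3 y x y
  have e4 := h1 x y x y
  simp only [polarization, add_comm y x] at *
  linear_combination (norm := abel) e1 + e2 + e3 - e4

theorem trace_mem_quad : (fun x => c x x) ∈ Quad G M := by
  have hb : ∀ x y y', polarization (fun x => c x x) x (y + y') =
      polarization (fun x => c x x) x y + polarization (fun x => c x x) x y' := by
    intro x y y'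
    simp only [polarization_trace hc]
    obtain ⟨h1, h2, h3, h4⟩ := hc
    linear_combination (norm := abel) h3 x y y' + h4 y y' x
  have hs : ∀ x y, polarization (fun x => c x x) x y = polarization (fun x => c x x) y x := by
    intro x y
    simp only [polarization_trace hc, add_comm]
  refine ⟨fun x => ?_, fun x x' y => ?_, hb⟩
  -- Evaluate the polarization at `(x, -x)`: it is `-2 q x` by bilinearity and `-q x - q (-x)` by
  -- definition.
  · have e1 := hb x x (-x)
    have e2 := polarization_trace hc x x
    have e3 : polarization (fun x => c x x) x 0 = 0 := by
      simp [polarization, cocycle_zero_right hc]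
    rw [add_neg_cancel, e3, e2] at e1
    simp only [polarization, add_neg_cancel, cocycle_zero_right hc] at e1
    linear_combination (norm := abel) e1
  · rw [hs, hb, hs y x, hs y x']

end Cocycle

/-- A cocycle with vanishing trace is cohomologous to one with vanishing braiding. -/
theorem exists_antisymmetrization {c : G → G → M} (h0 : ∀ x, c x 0 = 0)
    (hd : ∀ x, c x x = 0) (hs : ∀ x y, c x y + c y x = 0) :
    ∃ k : G → G → M, (∀ x, k x 0 = 0) ∧ (∀ y, k 0 y = 0) ∧ ∀ x y, c x y = k y x - k x y := by
  classical
  obtain ⟨_, _⟩ := exists_wellFoundedLT G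
  have h0' : ∀ x, c 0 x = 0 := fun x => by simpa [h0] using hs 0 x
  refine ⟨fun x y => if x < y then -c x y else 0, by simp [h0], by simp [h0'], fun x y => ?_⟩
  rcases lt_trichotomy x y with h | h | h
  · simp [h, h.not_gt]
  · simp [h, hd]
  · have := eq_neg_of_add_eq_zero_left (hs x y)
    simp [h, h.not_gt, this]

/-- The structure constant comparing `(a + b) + (a' + b')` with `(a + a') + (b + b')`. -/
def rect (h : G → G → G → M) (a b a' b' : G) : M :=
  h a a' (b + b') - h a b (a' + b') - h a' b' b

/-- A coherence identity on `G × G`: up to the coboundary of `rect`, the pullback of `h` along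
addition is the sum of its pullbacks along the two projections. -/
theorem IsSymmCocycle.rect_identity {h : G → G → G → M} (H : IsSymmCocycle h) (a b p q r s : G) :
    h (a + b) (p + q) (r + s) = h a p r + h b q s
      + (rect h p q r s - rect h (a + p) (b + q) r s
        + rect h a b (p + r) (q + s) - rect h a b p q) := by
  -- These three pentagons eliminate `a`, which no longer occurs in `key`.
  have A1 := H.pentagon a b (p + q) (r + s)
  have A2 := H.pentagon a p (b + q) (r + s)
  have A3 := H.pentagon a p r (b + q + s)
  have key : h b (p+q) (r+s) + h p q (r+s) - h p (b+q) (r+s) - h p r (q+s) + h p r (b+q+s)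
      + h r s q - h r s (b+q) + h (p+r) (q+s) b - h p q b - h b q s = 0 := by
    have B1 := H.hexagon (r+s) p (b+q)
    have B2 := H.hexagon' r s q
    have B3 := H.pentagon p r (q+s) b
    have B4 := H.hexagon b r (q+s)
    have B5 := H.pentagon (r+s) q b p
    have B6 := H.hexagon p q b
    have B7 := H.hexagon p (r+s) (b+q)
    have B8 := H.hexagon' b q (r+s)
    have B9 := H.pentagon (r+s) q p b
    have B10 := H.hexagon' (r+s) q p
    have B11 := H.hexagon' p q (r+s)
    have B12 := H.hexagon (r+s) b (p+q)
    have B13 := H.hexagon' (r+s) (p+q) b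
    have B14 := H.hexagon' s r (b+q)
    have B15 := H.hexagon' s (b+q) r
    have B16 := H.hexagon b (r+s) q
    have B17 := H.hexagon' q s r
    have B18 := H.pentagon b q s r
    have B19 := H.hexagon r b (q+s)
    have B20 := H.hexagon' (q+r+s) b p
    simp only [add_comm, add_left_comm] at *
    linear_combination (norm := abel) -B1 + B2 - B3 + B4 + B5 - B6 - B7 - B8 - B9
      + B10 + B11 + B12 + B13 - B14 - B15 - B16 + B17 - B18 + B19 + B20
  simp only [rect, add_comm, add_left_comm] at *
  linear_combination (norm := abel) key - A1 + A2 - A3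

end AbelianCohomology
-- Bilinear forms and extensions on free abelian groups
namespace AbelianCohomology

variable {V M : Type*} [AddCommGroup V] [AddCommGroup M]

theorem exists_bilin (f : V → V → M) (h1 : ∀ x x' y, f (x + x') y = f x y + f x' y)
    (h2 : ∀ x y y', f x (y + y') = f x y + f x y') :
    ∃ B : V →ₗ[ℤ] V →ₗ[ℤ] M, ∀ x y, B x y = f x y :=
  ⟨(AddMonoidHom.mk' (fun x => (AddMonoidHom.mk' (f x) (h2 x)).toIntLinearMap)
    fun x x' => LinearMap.ext fun y => h1 x x' y).toIntLinearMap, fun _ _ => rfl⟩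

/-- An alternating form on a free abelian group is the antisymmetrization of a bilinear form. -/
theorem exists_bilin_of_alternating [Module.Free ℤ V] (B : V →ₗ[ℤ] V →ₗ[ℤ] M)
    (hB : ∀ x, B x x = 0) : ∃ k : V →ₗ[ℤ] V →ₗ[ℤ] M, ∀ x y, k y x - k x y = B x y := by
  classical
  let b := Module.Free.chooseBasis ℤ V
  obtain ⟨_, _⟩ := exists_wellFoundedLT (Module.Free.ChooseBasisIndex ℤ V)
  have hs : ∀ x y, B x y = -B y x := fun x y => by
    have := hB (x + y)
    simp only [map_add, LinearMap.add_apply, hB] at this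
    exact eq_neg_of_add_eq_zero_left (by simpa [add_comm] using this)
  let k : V →ₗ[ℤ] V →ₗ[ℤ] M :=
    b.constr ℤ fun i => b.constr ℤ fun j => if j < i then B (b j) (b i) else 0
  refine ⟨k, fun x y => ?_⟩
  have : k.flip - k = B := b.ext fun i => b.ext fun j => by
    simp only [k, LinearMap.sub_apply, LinearMap.flip_apply, Module.Basis.constr_basis]
    rcases lt_trichotomy i j with h | rfl | h
    · simp [h, h.not_gt]
    · simp [hB]
    · simp [h, h.not_gt, hs (b i) (b j)]
  rw [← this]
  rfl

/-- A quadratic form on a free abelian group is the diagonal of a bilinear form. -/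
theorem exists_bilin_of_quad [Module.Free ℤ V] {q : V → M} (hq : q ∈ Quad V M) :
    ∃ B : V →ₗ[ℤ] V →ₗ[ℤ] M, ∀ x, B x x = q x := by
  classical
  let b := Module.Free.chooseBasis ℤ V
  obtain ⟨_, _⟩ := exists_wellFoundedLT (Module.Free.ChooseBasisIndex ℤ V)
  obtain ⟨hn, hl, hr⟩ := hq
  obtain ⟨P, hP⟩ := exists_bilin (polarization q) hl hr
  have hq0 : q 0 = 0 := by
    have := hP 0 0
    simpa [polarization, eq_comm] using this
  have hs : ∀ x y, P x y = P y x := fun x y => by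
    rw [hP, hP, polarization, polarization, add_comm y x, sub_right_comm]
  have hd : ∀ x, P x x = q x + q x := fun x => by
    have := hP x (-x)
    rw [map_neg, polarization, add_neg_cancel, hq0, hn] at this
    linear_combination (norm := abel) -this
  let B : V →ₗ[ℤ] V →ₗ[ℤ] M :=
    b.constr ℤ fun i => b.constr ℤ fun j =>
      if i < j then P (b i) (b j) else if i = j then q (b i) else 0
  have hBP : B + B.flip = P := b.ext fun i => b.ext fun j => by
    simp only [B, LinearMap.add_apply, LinearMap.flip_apply, Module.Basis.constr_basis]
    rcases lt_trichotomy i j with h | rfl | h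
    · simp [h, h.not_gt, h.ne']
    · simp [hd]
    · simp [h, h.not_gt, h.ne', hs (b i) (b j)]
  -- `B x x` and `q` have the same polarization, so their difference is additive and can be tested
  -- on the basis.
  let d : V →ₗ[ℤ] M := (AddMonoidHom.mk' (fun x => B x x - q x) fun x y => by
    have h1 := hP x y
    rw [← hBP, polarization] at h1
    simp only [map_add, LinearMap.add_apply, LinearMap.flip_apply] at h1 ⊢
    linear_combination (norm := abel) h1).toIntLinearMap
  have hd0 : d = 0 := b.ext fun i => by
    change B (b i) (b i) - q (b i) = 0
    simp [B, Module.Basis.constr_basis]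
  exact ⟨B, fun x => sub_eq_zero.1 (LinearMap.congr_fun hd0 x)⟩

/-- The abelian extension of `V` by `M` defined by a symmetric 2-cocycle. -/
@[ext]
structure Extension (K : V → V → M) where
  /-- the component in the kernel -/
  fst : M
  /-- the component in the quotient -/
  snd : V

/-- A symmetric 2-cocycle makes the extension an abelian group. -/
abbrev Extension.addCommGroup {K : V → V → M} (h0 : ∀ y, K 0 y = 0) (hs : ∀ x y, K x y = K y x)
    (hK : ∀ x y z, delta K x y z = 0) : AddCommGroup (Extension K) where
  add p q := ⟨p.1 + q.1 + K p.2 q.2, p.2 + q.2⟩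
  zero := ⟨0, 0⟩
  neg p := ⟨-p.1 - K (-p.2) p.2, -p.2⟩
  nsmul := @nsmulRec _ ⟨⟨0, 0⟩⟩ ⟨fun p q => ⟨p.1 + q.1 + K p.2 q.2, p.2 + q.2⟩⟩
  zsmul := @zsmulRec _ ⟨⟨0, 0⟩⟩ ⟨fun p q => ⟨p.1 + q.1 + K p.2 q.2, p.2 + q.2⟩⟩
    ⟨fun p => ⟨-p.1 - K (-p.2) p.2, -p.2⟩⟩
    (@nsmulRec _ ⟨⟨0, 0⟩⟩ ⟨fun p q => ⟨p.1 + q.1 + K p.2 q.2, p.2 + q.2⟩⟩)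
  add_assoc p q r := by
    have := hK p.2 q.2 r.2
    refine Extension.ext ?_ (add_assoc _ _ _)
    change p.1 + q.1 + K p.2 q.2 + r.1 + K (p.2 + q.2) r.2
      = p.1 + (q.1 + r.1 + K q.2 r.2) + K p.2 (q.2 + r.2)
    rw [delta] at this
    linear_combination (norm := abel) -this
  zero_add p := Extension.ext (by change 0 + p.1 + K 0 p.2 = p.1; simp [h0]) (zero_add _)
  add_zero p := Extension.ext (by change p.1 + 0 + K p.2 0 = p.1; simp [hs p.2 0, h0]) (add_zero _)
  neg_add_cancel p := Extension.ext
    (by change -p.1 - K (-p.2) p.2 + p.1 + K (-p.2) p.2 = 0; abel) (neg_add_cancel _)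
  add_comm p q := Extension.ext
    (by change p.1 + q.1 + K p.2 q.2 = q.1 + p.1 + K q.2 p.2; rw [hs, add_comm p.1]) (add_comm _ _)

/-- A symmetric 2-cocycle on a free abelian group is a coboundary. -/
theorem exists_splitting [Module.Free ℤ V] {K : V → V → M} (h0 : ∀ y, K 0 y = 0)
    (hs : ∀ x y, K x y = K y x) (hK : ∀ x y z, delta K x y z = 0) :
    ∃ f : V → M, ∀ x y, K x y = f x + f y - f (x + y) := by
  let b := Module.Free.chooseBasis ℤ V
  let _ := Extension.addCommGroup h0 hs hK
  let p : Extension K →+ V := AddMonoidHom.mk' Extension.snd fun _ _ => rfl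
  -- A linear section exists because `V` is free; its `M`-component is a primitive of `K` up to
  -- sign.
  let s : V →ₗ[ℤ] Extension K := b.constr ℤ fun i => ⟨0, b i⟩
  have hps : p.toIntLinearMap ∘ₗ s = LinearMap.id := b.ext fun i => by
    simp only [s, LinearMap.comp_apply, Module.Basis.constr_basis]
    rfl
  have hp : ∀ x, (s x).snd = x := fun x => LinearMap.congr_fun hps x
  refine ⟨fun x => -(s x).fst, fun x y => ?_⟩
  have h1 : (s (x + y)).fst = (s x).fst + (s y).fst + K (s x).snd (s y).snd := by
    rw [map_add]; rfl
  rw [hp, hp] at h1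
  change K x y = -(s x).fst + -(s y).fst - -(s (x + y)).fst
  rw [h1]
  abel

end AbelianCohomology
-- Symmetric cocycles on `ℤ` and on `ι →₀ ℤ` are coboundaries
namespace AbelianCohomology

variable {G M : Type*} [AddCommGroup G] [AddCommGroup M]

theorem IsSymmCocycle.left_zero {h : G → G → G → M} (H : IsSymmCocycle h) (y z : G) :
    h 0 y z = 0 := by
  have := H.pentagon 0 0 y z
  simpa [H.mid_zero] using this

theorem IsSymmCocycle.right_zero {h : G → G → G → M} (H : IsSymmCocycle h) (x y : G) :
    h x y 0 = 0 := by
  have := H.pentagon x y 0 0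
  simpa [H.mid_zero] using this

theorem IsSymmCocycle.comp {G' : Type*} [AddCommGroup G'] {h : G → G → G → M}
    (H : IsSymmCocycle h) (f : G' →+ G) : IsSymmCocycle fun x y z => h (f x) (f y) (f z) where
  pentagon u x y z := by simpa using H.pentagon (f u) (f x) (f y) (f z)
  mid_zero x z := by simpa using H.mid_zero (f x) (f z)
  hexagon x y z := H.hexagon (f x) (f y) (f z)
  hexagon' x y z := H.hexagon' (f x) (f y) (f z)

theorem exists_int_primitive (g : ℤ → M) : ∃ f : ℤ → M, f 0 = 0 ∧ ∀ n, f (n + 1) = f n + g n := by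
  -- Truncation by `toNat` empties at least one of the two sums.
  refine ⟨fun n => ∑ i ∈ Finset.range n.toNat, g i - ∑ i ∈ Finset.range (-n).toNat, g (-(i + 1)),
    by simp, fun n => ?_⟩
  obtain ⟨m, rfl | rfl⟩ := n.eq_nat_or_neg
  · have h1 : ((m : ℤ) + 1).toNat = m + 1 := by omega
    have h2 : (-((m : ℤ) + 1)).toNat = 0 := by omega
    have h3 : (-(m : ℤ)).toNat = 0 := by omega
    simp only [h1, h2, h3, Int.toNat_natCast, Finset.sum_range_succ, Finset.sum_range_zero,
      sub_zero]
  · cases m with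
    | zero => simp
    | succ m =>
      have h1 : (-((m + 1 : ℕ) : ℤ) + 1).toNat = 0 := by omega
      have h2 : (-(-((m + 1 : ℕ) : ℤ) + 1)).toNat = m := by omega
      have h3 : (-((m + 1 : ℕ) : ℤ)).toNat = 0 := by omega
      have h4 : (- -((m + 1 : ℕ) : ℤ)).toNat = m + 1 := by omega
      simp only [h1, h2, h3, h4, Finset.sum_range_succ, Finset.sum_range_zero]
      push_cast
      abel

theorem IsSymmCocycle.exists_delta_int {h : ℤ → ℤ → ℤ → M} (H : IsSymmCocycle h) :
    ∃ k : ℤ → ℤ → M, k 0 0 = 0 ∧ ∀ x y z, h x y z = delta k x y z := by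
  -- With `k 0 z = k 1 z = 0`, the equation `h = delta k` at `x = 1` reads `k (y + 1) z = k y z - h
  -- 1 y z`; the pentagon with `u = 1` propagates it to all `x`.
  choose f hf0 hf using fun z => exists_int_primitive fun y => -h 1 y z
  refine ⟨fun y z => f z y, hf0 0, ?_⟩
  have hf1 : ∀ z, f z 1 = 0 := fun z => by simpa [hf0, H.mid_zero] using hf z 0
  have hstep : ∀ x y z, h (x + 1) y z - delta (fun y z => f z y) (x + 1) y z
      = h x y z - delta (fun y z => f z y) x y z := by
    intro x y z
    have e := H.pentagon 1 x y z
    have e1 := hf z (x + y)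
    have e2 := hf (y + z) x
    have e3 := hf y x
    rw [add_comm 1 x] at e
    simp only [delta]
    rw [show x + 1 + y = x + y + 1 by ring]
    linear_combination (norm := abel) -e + e1 - e2 + e3
  have h0 : ∀ y z, h 0 y z - delta (fun y z => f z y) 0 y z = 0 := by
    intro y z
    simp [H.left_zero, delta, hf0]
  intro x y z
  rw [← sub_eq_zero]
  induction x with
  | zero => exact h0 y z
  | succ n ih => rw [hstep, ih]
  | pred n ih => rw [← hstep, sub_add_cancel, ih]

theorem IsSymmCocycle.rect_eq_zero {h : G → G → G → M} (H : IsSymmCocycle h) (a a' : G) :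
    rect h a 0 a' 0 = 0 := by
  simp [rect, H.mid_zero, H.right_zero]

theorem IsSymmCocycle.exists_delta_finsupp {ι : Type*}
    {h : (ι →₀ ℤ) → (ι →₀ ℤ) → (ι →₀ ℤ) → M} (H : IsSymmCocycle h) :
    ∃ k : (ι →₀ ℤ) → (ι →₀ ℤ) → M, ∀ x y z, h x y z = delta k x y z := by
  classical
  obtain ⟨_, _⟩ := exists_wellFoundedLT ι
  choose κ hκ0 hκ using fun i : ι => (H.comp (Finsupp.singleAddHom i)).exists_delta_int
  let lo (i : ι) : (ι →₀ ℤ) →+ (ι →₀ ℤ) := Finsupp.filterAddHom (· < i)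
  have hloa : ∀ i x j, lo i x j = if j < i then x j else 0 := fun i x j =>
    Finsupp.filter_apply (· < i) x j
  -- The contribution of adjoining coordinate `i` to the smaller ones: `rect` for the splitting, `κ
  -- i` for the new rank-one summand.
  let t (x y : ι →₀ ℤ) (i : ι) : M :=
    rect h (lo i x) (Finsupp.single i (x i)) (lo i y) (Finsupp.single i (y i)) + κ i (x i) (y i)
  have ht : ∀ x y i, i ∉ x.support ∪ y.support → t x y i = 0 := by
    intro x y i hi
    simp only [Finset.mem_union, Finsupp.mem_support_iff, not_or, not_not] at hi
    simp [t, hi.1, hi.2, H.rect_eq_zero, hκ0]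
  have key : ∀ S : Finset ι, ∀ x y z : ι →₀ ℤ, x.support ⊆ S → y.support ⊆ S → z.support ⊆ S →
      h x y z = delta (fun x y => ∑ i ∈ S, t x y i) x y z := by
    intro S
    induction S using Finset.induction_on_max with
    | empty =>
      intro x y z hx _ _
      rw [Finset.subset_empty, Finsupp.support_eq_empty] at hx
      simp [hx, H.left_zero, delta]
    | insert m S hm ih =>
      have hmS : m ∉ S := fun hmem => lt_irrefl _ (hm m hmem)
      have hdec : ∀ x : ι →₀ ℤ, x.support ⊆ insert m S → lo m x + Finsupp.single m (x m) = x := by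
        intro x hx
        ext j
        rcases eq_or_ne j m with rfl | hj
        · simp [hloa]
        · by_cases hjx : x j = 0
          · simp [hloa, hjx, hj.symm]
          · have hjS := (Finset.mem_insert.1 (hx (Finsupp.mem_support_iff.2 hjx))).resolve_left hj
            simp [hloa, hm j hjS, hj.symm]
      have hlo : ∀ x : ι →₀ ℤ, x.support ⊆ insert m S → (lo m x).support ⊆ S := by
        intro x hx j hj
        rw [Finsupp.mem_support_iff, hloa, ne_eq, ite_eq_right_iff, Classical.not_imp] at hj
        exact (Finset.mem_insert.1 (hx (Finsupp.mem_support_iff.2 hj.2))).resolve_left hj.1.ne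
      have hsum : ∀ x y : ι →₀ ℤ, ∑ i ∈ S, t (lo m x) (lo m y) i = ∑ i ∈ S, t x y i := by
        intro x y
        refine Finset.sum_congr rfl fun i hi => ?_
        have h1 : ∀ x : ι →₀ ℤ, lo i (lo m x) = lo i x := by
          intro x
          ext j
          by_cases hj : j < i
          · simp [hloa, hj, hj.trans (hm i hi)]
          · simp [hloa, hj]
        have h2 : ∀ x : ι →₀ ℤ, lo m x i = x i := by
          intro x
          simp [hloa, hm i hi]
        simp only [t, h1, h2]
      intro x y z hx hy hz
      have e1 := H.rect_identity (lo m x) (Finsupp.single m (x m)) (lo m y)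
        (Finsupp.single m (y m)) (lo m z) (Finsupp.single m (z m))
      have e2 := ih _ _ _ (hlo x hx) (hlo y hy) (hlo z hz)
      have e3 := hκ m (x m) (y m) (z m)
      simp only [Finsupp.singleAddHom_apply] at e3
      rw [hdec x hx, hdec y hy, hdec z hz, e2, e3] at e1
      rw [e1]
      simp only [delta, ← map_add, hsum, Finset.sum_insert hmS, ← Finsupp.single_add]
      simp only [t, Finsupp.add_apply]
      abel
  refine ⟨fun x y => ∑ i ∈ x.support ∪ y.support, t x y i, fun x y z => ?_⟩
  let S := x.support ∪ y.support ∪ z.support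
  have hS : ∀ x y : ι →₀ ℤ, x.support ⊆ S → y.support ⊆ S →
      ∑ i ∈ x.support ∪ y.support, t x y i = ∑ i ∈ S, t x y i := fun x y hx hy =>
    Finset.sum_subset (Finset.union_subset hx hy) fun i _ hi => ht x y i hi
  have hx : x.support ⊆ S := fun i hi => by simp only [S, Finset.mem_union, hi, true_or]
  have hy : y.support ⊆ S := fun i hi => by simp only [S, Finset.mem_union, hi, true_or, or_true]
  have hz : z.support ⊆ S := fun i hi => by simp only [S, Finset.mem_union, hi, or_true]
  have hadd : ∀ x y : ι →₀ ℤ, x.support ⊆ S → y.support ⊆ S → (x + y).support ⊆ S :=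
    fun x y hx hy => Finsupp.support_add.trans (Finset.union_subset hx hy)
  rw [key S x y z hx hy hz]
  simp only [delta, hS _ _ hy hz, hS _ _ (hadd x y hx hy) hz, hS _ _ hx (hadd y z hy hz),
    hS _ _ hx hy]

end AbelianCohomology
-- Symmetric primitives, descent to `G`, and injectivity
namespace AbelianCohomology

variable {G M : Type*} [AddCommGroup G] [AddCommGroup M]

/-- By the hexagon, the antisymmetrization of a primitive is bilinear and alternating, so a bilinear
correction, which `delta` kills, makes the primitive symmetric. -/
theorem IsSymmCocycle.exists_symm_delta_of_free {V : Type*} [AddCommGroup V] [Module.Free ℤ V]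
    {h : V → V → V → M} (H : IsSymmCocycle h) :
    ∃ k : V → V → M, (∀ y, k 0 y = 0) ∧ (∀ x y, k x y = k y x) ∧
      ∀ x y z, h x y z = delta k x y z := by
  let b := Module.Free.chooseBasis ℤ V
  obtain ⟨k₀, hk₀⟩ := (H.comp b.repr.symm.toLinearMap.toAddMonoidHom).exists_delta_finsupp
  let k₁ (x y : V) : M := k₀ (b.repr x) (b.repr y)
  have hk₁ : ∀ x y z, h x y z = delta k₁ x y z := fun x y z => by
    simpa [delta, k₁] using hk₀ (b.repr x) (b.repr y) (b.repr z)
  have hr : ∀ x y z, k₁ x (y + z) - k₁ (y + z) x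
      = (k₁ x y - k₁ y x) + (k₁ x z - k₁ z x) := by
    intro x y z
    have e := H.hexagon x y z
    simp only [hk₁, delta, add_comm z x, add_comm y x] at e
    linear_combination (norm := abel) e
  obtain ⟨D, hD⟩ := exists_bilin (fun x y => k₁ x y - k₁ y x)
    (fun x x' y => by linear_combination (norm := abel) -hr y x x') hr
  obtain ⟨k', hk'⟩ := exists_bilin_of_alternating D fun x => by rw [hD, sub_self]
  let k₂ (x y : V) : M := k₁ x y + k' x y
  have hk₂ : ∀ x y z, h x y z = delta k₂ x y z := by
    intro x y z
    simp only [hk₁, delta, k₂, map_add, LinearMap.add_apply]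
    abel
  refine ⟨fun x y => k₂ x y - k₂ 0 0, fun y => ?_, fun x y => ?_, fun x y z => ?_⟩
  · have e := hk₂ 0 0 y
    rw [H.left_zero] at e
    simp only [delta, zero_add] at e
    change k₂ 0 y - k₂ 0 0 = 0
    linear_combination (norm := abel) -e
  · have e := hk' x y
    rw [hD] at e
    simp only [k₂]
    linear_combination (norm := abel) -e
  · rw [hk₂]
    simp only [delta]
    abel

/-- Every abelian group is a quotient of a free one; the section may be taken to fix zero. -/
theorem exists_section (G : Type*) [AddCommGroup G] :
    ∃ (π : (G →₀ ℤ) →ₗ[ℤ] G) (s : G → G →₀ ℤ), s 0 = 0 ∧ ∀ x, π (s x) = x := by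
  classical
  refine ⟨Finsupp.linearCombination ℤ id, fun x => if x = 0 then 0 else Finsupp.single x 1,
    by simp, fun x => ?_⟩
  by_cases hx : x = 0 <;> simp [hx]

theorem exists_descent {V : Type*} [AddCommGroup V] [Module.Free ℤ V] (π : V →ₗ[ℤ] G)
    {s : G → V} (hs0 : s 0 = 0) (hs : ∀ x, π (s x) = x) {h : G → G → G → M}
    (hr0 : ∀ x y, h x y 0 = 0) {K : V → V → M} (h0 : ∀ y, K 0 y = 0)
    (hsymm : ∀ x y, K x y = K y x) (hK : ∀ x y z, h (π x) (π y) (π z) = delta K x y z) :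
    ∃ k : G → G → M, (∀ y, k 0 y = 0) ∧ (∀ x y, k x y = k y x) ∧
      ∀ x y z, h x y z = delta k x y z := by
  have := free_submodule (LinearMap.ker π)
  obtain ⟨f, hf⟩ := exists_splitting (V := LinearMap.ker π) (K := fun r r' => K r r')
    (fun y => h0 y) (fun x y => hsymm x y) fun x y z => by
      have e := hK x y z
      rw [LinearMap.mem_ker.1 z.2, hr0] at e
      exact e.symm
  have hf0 : f 0 = 0 := by simpa [h0] using (hf 0 0).symm
  have hmem : ∀ x, x - s (π x) ∈ LinearMap.ker π := fun x => by
    rw [LinearMap.mem_ker, map_sub, hs, sub_self]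
  -- This choice is forced by `g ∘ s = 0`, `g = f` on the kernel and `K' (s x) r = 0`.
  let g (x : V) : M := f ⟨x - s (π x), hmem x⟩ - K (s (π x)) (x - s (π x))
  let K' (x y : V) : M := K x y - g x - g y + g (x + y)
  have hK' : ∀ x y z, h (π x) (π y) (π z) = delta K' x y z := by
    intro x y z
    simp only [hK, delta, K', add_assoc]
    abel
  have hsymm' : ∀ x y, K' x y = K' y x := by
    intro x y
    simp only [K', hsymm x y, add_comm x y]
    abel
  have hgs : ∀ x, g (s x) = 0 := by
    intro x
    simp only [g, hs, sub_self, hsymm (s x) 0, h0, sub_zero]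
    exact hf0
  have hg : ∀ x (r : LinearMap.ker π), g (s x + r) = f r - K (s x) r := by
    intro x r
    have e : π (s x + r) = x := by rw [map_add, hs, LinearMap.mem_ker.1 r.2, add_zero]
    simp only [g, e, add_sub_cancel_left, Subtype.coe_eta]
  have hg' : ∀ r : LinearMap.ker π, g r = f r := by
    intro r
    simpa [hs0, h0] using hg 0 r
  have hz : ∀ x (r : LinearMap.ker π), K' (s x) r = 0 := by
    intro x r
    simp only [K', hgs, hg, hg']
    abel
  have hrr : ∀ r r' : LinearMap.ker π, K' r r' = 0 := by
    intro r r'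
    have e := hz 0 r
    have := hg' (r + r')
    simp only [Submodule.coe_add] at this
    simp only [K', hg', this]
    linear_combination (norm := abel) hf r r'
  have hall : ∀ x (r : LinearMap.ker π), K' x r = 0 := by
    intro x r
    -- The cocycle identity spreads the vanishing from the section and the kernel to all of `V`.
    have e := hK' (s (π x)) (x - s (π x)) r
    rw [LinearMap.mem_ker.1 r.2, hr0, delta, add_sub_cancel] at e
    have e1 := hrr ⟨_, hmem x⟩ r
    have e2 := hz (π x) (⟨_, hmem x⟩ + r)
    have e3 := hz (π x) ⟨_, hmem x⟩
    simp only [Submodule.coe_add] at e1 e2 e3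
    linear_combination (norm := abel) e + e1 + e2 - e3
  have hinv : ∀ x y (r : LinearMap.ker π), K' x (y + r) = K' x y := by
    intro x y r
    have e := hK' x y r
    rw [LinearMap.mem_ker.1 r.2, hr0, delta, hall, hall] at e
    linear_combination (norm := abel) -e
  have hsec : ∀ x y, K' x y = K' x (s (π y)) := by
    intro x y
    simpa using hinv x (s (π y)) ⟨_, hmem y⟩
  refine ⟨fun x y => K' (s x) (s y), fun y => ?_, fun x y => hsymm' _ _, fun x y z => ?_⟩
  · change K' (s 0) (s y) = 0
    rw [hs0, hsymm']
    exact hall _ 0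
  · have e := hK' (s x) (s y) (s z)
    rw [hs, hs, hs, delta, hsec (s x) (s y + s z), hsymm' (s x + s y), hsec (s z) (s x + s y),
      hsymm' (s z)] at e
    simpa only [map_add, hs, delta] using e

theorem IsSymmCocycle.exists_delta {h : G → G → G → M} (H : IsSymmCocycle h) :
    ∃ k : G → G → M, (∀ y, k 0 y = 0) ∧ (∀ x y, k x y = k y x) ∧
      ∀ x y z, h x y z = delta k x y z := by
  obtain ⟨π, s, hs0, hs⟩ := exists_section G
  obtain ⟨K, h0, hsymm, hK⟩ := (H.comp π.toAddMonoidHom).exists_symm_delta_of_free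
  exact exists_descent π hs0 hs H.right_zero h0 hsymm hK

/-- An abelian 3-cocycle with vanishing trace is a coboundary. -/
theorem mem_coboundaries_of_trace_eq_zero {p : (G → G → G → M) × (G → G → M)}
    (hp : p ∈ cocycles G M) (ht : ∀ x, p.2 x x = 0) : p ∈ coboundaries G M := by
  obtain ⟨k₁, hk0, hk0', hk₁⟩ := exists_antisymmetrization (cocycle_zero_right hp) ht fun x y => by
    rw [← polarization_trace hp, polarization]
    simp [ht]
  let p₁ : (G → G → G → M) × (G → G → M) := (delta k₁, fun x y => k₁ y x - k₁ x y)
  have hp₁ : p₁ ∈ coboundaries G M := ⟨k₁, hk0, hk0', fun _ _ _ => rfl, fun _ _ => rfl⟩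
  obtain ⟨a1, a2, a3, a4⟩ := (cocycles G M).sub_mem hp (coboundaries_le_cocycles G M hp₁)
  have hc : ∀ x y, (p - p₁).2 x y = 0 := fun x y => sub_eq_zero.2 (hk₁ x y)
  have H : IsSymmCocycle (p - p₁).1 :=
    ⟨a1, a2, fun x y z => by simpa [hc] using a3 x y z, fun x y z => by
      have := a4 x y z
      simp only [hc] at this
      linear_combination (norm := abel) -this⟩
  obtain ⟨k, h0, hsymm, hk⟩ := H.exists_delta
  rw [← sub_add_cancel p p₁]
  exact (coboundaries G M).add_mem ⟨k, fun x => by rw [hsymm, h0], h0, hk, fun x y => by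
    rw [hc, hsymm, sub_self]⟩ hp₁

end AbelianCohomology
-- Surjectivity and the isomorphism
namespace AbelianCohomology

variable {G M : Type*} [AddCommGroup G] [AddCommGroup M]

/-- Every quadratic form is the trace of an abelian 3-cocycle. -/
theorem exists_cocycle_of_quad {q : G → M} (hq : q ∈ Quad G M) :
    ∃ p ∈ cocycles G M, ∀ x, p.2 x x = q x := by
  obtain ⟨π, s, hs0, hs⟩ := exists_section G
  have hqπ : q ∘ π ∈ Quad (G →₀ ℤ) M := by
    obtain ⟨h1, h2, h3⟩ := hq
    refine ⟨fun x => by simp [h1], fun x x' y => ?_, fun x y y' => ?_⟩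
    · simpa [polarization] using h2 (π x) (π x') (π y)
    · simpa [polarization] using h3 (π x) (π y) (π y')
  obtain ⟨B, hB⟩ := exists_bilin_of_quad hqπ
  have hq0 : q 0 = 0 := by simpa using (hB 0).symm
  -- `q ∘ π` is unchanged under translation by the kernel.
  have hanti : ∀ (r : LinearMap.ker π) x, B r x + B x r = 0 := by
    intro r x
    have e := hB (r + x)
    simp only [map_add, LinearMap.add_apply, hB, Function.comp_apply, LinearMap.mem_ker.1 r.2,
      zero_add, hq0] at e
    linear_combination (norm := abel) e
  have := free_submodule (LinearMap.ker π)
  obtain ⟨k, hk⟩ := exists_bilin_of_alternating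
    ((B.compl₂ (LinearMap.ker π).subtype).comp (LinearMap.ker π).subtype) fun r => by
      change B r r = 0
      rw [hB, Function.comp_apply, LinearMap.mem_ker.1 r.2, hq0]
  replace hk : ∀ r r' : LinearMap.ker π, k r' r - k r r' = B r r' := hk
  let ρ (x y : G) : LinearMap.ker π := ⟨s x + s y - s (x + y), by simp [hs]⟩
  have hρ : ∀ x y, (ρ x y : G →₀ ℤ) = s x + s y - s (x + y) := fun _ _ => rfl
  have hρs : ∀ x y, ρ x y = ρ y x := fun x y => Subtype.ext (by simp only [hρ, add_comm])
  have hρc : ∀ x y z, ρ y z + ρ x (y + z) = ρ x y + ρ (x + y) z := fun x y z => Subtype.ext (by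
    simp only [Submodule.coe_add, hρ, add_assoc]
    abel)
  have hρ0 : ∀ x, ρ x 0 = 0 := fun x => Subtype.ext (by simp [hρ, hs0])
  have hρ0' : ∀ x, ρ 0 x = 0 := fun x => by rw [hρs, hρ0]
  -- `B (s x) (ρ y z)` measures the failure of `c` to be additive in its second variable. It
  -- violates the pentagon by `B (ρ u x) (ρ y z)`, which the `k`-terms compensate; these drop out of
  -- the hexagons since `ρ` is symmetric.
  refine ⟨(fun x y z => k (ρ x y) (ρ (x + y) z) - k (ρ y z) (ρ x (y + z)) + B (s x) (ρ y z),
    fun x y => B (s x) (s y)), ⟨fun u x y z => ?_, fun x z => ?_, fun x y z => ?_,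
      fun x y z => ?_⟩, fun x => ?_⟩
  · have e1 : B (ρ u x) (ρ y z) = B (s u) (ρ y z) + B (s x) (ρ y z) - B (s (u + x)) (ρ y z) := by
      simp only [hρ u x, map_add, map_sub, LinearMap.add_apply, LinearMap.sub_apply]
    have e2 := hk (ρ u x) (ρ y z)
    have c1 : ρ x (y + z) = ρ x y + ρ (x + y) z - ρ y z := by rw [← hρc, add_sub_cancel_left]
    have c2 : ρ u (x + y) = ρ (x + y) z + ρ u (x + y + z) - ρ (u + (x + y)) z := by
      rw [hρc, add_sub_cancel_right]
    have c3 : ρ (u + x) y = ρ x y + ρ u (x + y) - ρ u x := by rw [hρc, add_sub_cancel_left]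
    have c4 : ρ (u + x) (y + z) = ρ x (y + z) + ρ u (x + (y + z)) - ρ u x := by
      rw [hρc, add_sub_cancel_left]
    rw [e1] at e2
    simp only [c4, c3, c2, c1, ← add_assoc]
    simp only [Submodule.coe_add, Submodule.coe_sub, map_add, map_sub, LinearMap.add_apply,
      LinearMap.sub_apply]
    linear_combination (norm := abel) -e2
  · simp [hρ0, hρ0']
  · have e : B (s x) (ρ y z) = B (s x) (s y) + B (s x) (s z) - B (s x) (s (y + z)) := by
      simp only [hρ, map_add, map_sub]
    simp only [hρs z x, hρs y x, add_comm z x, add_comm y x, hρs (y + z) x] at e ⊢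
    linear_combination (norm := abel) e
  · have e : B (ρ x y) (s z) = B (s x) (s z) + B (s y) (s z) - B (s (x + y)) (s z) := by
      simp only [hρ, map_add, map_sub, LinearMap.add_apply, LinearMap.sub_apply]
    have e' := hanti (ρ x y) (s z)
    simp only [hρs z x, hρs z y, add_comm z x, add_comm z y, hρs z (x + y)] at e ⊢
    linear_combination (norm := abel) e - e'
  · change B (s x) (s x) = q x
    rw [hB, Function.comp_apply, hs]

/-- The trace of an abelian 3-cocycle, as a homomorphism. -/
def cocycleTrace (G M : Type*) [AddCommGroup G] [AddCommGroup M] : cocycles G M →+ Quad G M :=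
  AddMonoidHom.mk' (fun p => ⟨fun x => p.1.2 x x, trace_mem_quad p.2⟩) fun _ _ => rfl

theorem cocycleTrace_surjective : Function.Surjective (cocycleTrace G M) := by
  rintro ⟨q, hq⟩
  obtain ⟨p, hp, hpq⟩ := exists_cocycle_of_quad hq
  exact ⟨⟨p, hp⟩, Subtype.ext (funext hpq)⟩

theorem ker_cocycleTrace :
    (coboundaries G M).addSubgroupOf (cocycles G M) = (cocycleTrace G M).ker := by
  ext p
  rw [AddSubgroup.mem_addSubgroupOf, AddMonoidHom.mem_ker]
  constructor
  · rintro ⟨k, -, -, -, hc⟩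
    exact Subtype.ext (funext fun x => (hc x x).trans (sub_self _))
  · intro hp
    exact mem_coboundaries_of_trace_eq_zero p.2 fun x => congrFun (congrArg Subtype.val hp) x

end AbelianCohomology

theorem mainTheorem9 (G M : Type*) [AddCommGroup G] [AddCommGroup M] :
    ∃ tr : AbelianCohomology.H3ab G M ≃+ AbelianCohomology.Quad G M,
      ∀ (p : AbelianCohomology.cocycles G M) (x : G),
        (tr (QuotientAddGroup.mk p) : G → M) x = (p : (G → G → G → M) × (G → G → M)).2 x x :=
  ⟨(QuotientAddGroup.quotientAddEquivOfEq AbelianCohomology.ker_cocycleTrace).trans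
    (QuotientAddGroup.quotientKerEquivOfSurjective _ AbelianCohomology.cocycleTrace_surjective),
    fun _ _ => rfl⟩
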